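/- Let $0<p<1$. In the Bernoulli model, random series-parallel networks are grown as follows. The network of size $1$ is a single edge, labelled $1$, directed from the source to the sink. In step $n>1$ one of the $n-1$ edges of the network of size $n-1$, say $j=(x,y)$, is chosen uniformly at random; independently, with probability $p$ it is doubled in a parallel way (a new edge $(x,y)$ labelled $n$ is inserted to the right of edge $j$), and with probability $1-p$ it is doubled in a serial way (it is replaced by the edges $(x,z)$, labelled $j$, and $(z,y)$, labelled $n$, where $z$ is a new node). Let $L_n^{[L]}=L_n^{[L]}(p)$ be the length (number of edges) of the leftmost source-to-sink path of the network of size $n$, i.e. of the path that starts at the source and takes at each node the leftmost outgoing edge until it arrives at the sink, and let $D_n=D_n(p)$ be the degree of the source. Then: (a) For all integers $1\le m\le n$, $$\mathbb{P}\{L_n^{[L]}=m\}=\sum_{j=0}^{m-1}\binom{m-1}{j}(-1)^{n+j-1}\binom{j-p(j+1)}{n-1},$$ where $\binom{x}{k}=x(x-1)\cdots(x-k+1)/k!$ for real $x$. (b) For all $n\ge 1$, $L_n^{[L]}(p)$ has the same distribution as $D_n(1-p)$. (c) There is exactly one probability distribution on $\mathbb{R}$, called Mittag-Leffler$(1-p)$,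 whose $r$-th moment is $\dfrac{r!}{\Gamma(r(1-p)+1)}$ for every integer $r\ge 0$, and, as $n\to\infty$, $L_n^{[L]}/n^{1-p}$ converges in distribution to it. -/

import Mathlib

open Filter MeasureTheory ProbabilityTheory
open scoped unitInterval

/-- A directed edge from node `tail` to node `head`, carrying the integer `label`. -/
@[ext]
structure SPEdge where
  label : ℕ
  tail : ℕ
  head : ℕ

/-- A plane two-terminal directed multigraph with nodes `0, …, nodeCount - 1`. The source is node
`0` and the sink is node `1`. The order of the list `edges` encodes the plane drawing: the edges
leaving a node `v`, read from left to right, are the members of `edges` with tail `v`, in the order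
in which they occur in the list. -/
@[ext]
structure SPNetwork where
  nodeCount : ℕ
  edges : List SPEdge

namespace SPNetwork

/-- All sets of networks are events. -/
instance : MeasurableSpace SPNetwork := ⊤

/-- The network of size `1`: one edge, labelled `1`, from the source to the sink. -/
def initial : SPNetwork where
  nodeCount := 2
  edges := [⟨1, 0, 1⟩]

/-- Parallel doubling of the edge `j = (x, y)`: a new edge `(x, y)`, labelled `n`, is inserted
directly to the right of it. -/
def parallel (G : SPNetwork) (j n : ℕ) : SPNetwork where
  nodeCount := G.nodeCount
  edges := G.edges.flatMap fun e =>
    if e.label = j then [e, ⟨n, e.tail, e.head⟩] else [e]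

/-- Serial doubling of the edge `j = (x, y)`: it is replaced by `(x, z)`, labelled `j`, and
`(z, y)`, labelled `n`, where `z` is a new node. -/
def serial (G : SPNetwork) (j n : ℕ) : SPNetwork where
  nodeCount := G.nodeCount + 1
  edges := G.edges.flatMap fun e =>
    if e.label = j then [⟨j, e.tail, G.nodeCount⟩, ⟨n, G.nodeCount, e.head⟩] else [e]

/-- The degree of the source: the number of edges incident with node `0`. -/
def sourceDegree (G : SPNetwork) : ℕ :=
  G.edges.countP fun e => e.tail = 0 ∨ e.head = 0

/-- One step of the leftmost path: from `v` traverse the first (leftmost) edge leaving `v`; stay at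
`v` if no edge leaves `v`. -/
def leftmostStep (G : SPNetwork) (v : ℕ) : ℕ :=
  match G.edges.find? fun e => e.tail = v with
  | some e => e.head
  | none => v

/-- The length of the leftmost source-to-sink path: the number of edges that are traversed until
the walk that starts at the source and always takes the leftmost outgoing edge reaches the sink. -/
noncomputable def leftmostLength (G : SPNetwork) : ℕ :=
  sInf {k : ℕ | G.leftmostStep^[k] 0 = 1}

end SPNetwork

/-- A coin showing `true` with probability `p` and `false` with probability `1 - p`. -/
noncomputable def coin (p : I) : PMF Bool :=
  PMF.ofFintype (fun b => ENNReal.ofReal (if b then (p : ℝ) else 1 - (p : ℝ))) (by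
    have h0 : (0 : ℝ) ≤ p := p.2.1
    have h1 : (0 : ℝ) ≤ 1 - (p : ℝ) := sub_nonneg.2 p.2.2
    simp [← ENNReal.ofReal_add h0 h1])

/-- The law of the random network of size `n` in the Bernoulli model with parameter `p`: in step
`n > 1` an edge `j ∈ {1, …, n - 1}` of the network of size `n - 1` is chosen uniformly at random and,
independently, it is doubled in a parallel way with probability `p` and in a serial way with
probability `1 - p`. (The value at `n = 0` is a convention; sizes start at `1`.) -/
noncomputable def bernoulliNetwork (p : I) : ℕ → PMF SPNetwork
  | 0 => PMF.pure SPNetwork.initial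
  | 1 => PMF.pure SPNetwork.initial
  | n + 2 =>
    (bernoulliNetwork p (n + 1)).bind fun G =>
      (PMF.uniformOfFinset (Finset.Icc 1 (n + 1)) ⟨1, by simp⟩).bind fun j =>
        (coin p).map fun b => if b then G.parallel j (n + 2) else G.serial j (n + 2)

/-- The distribution `ν` on the real line is Mittag-Leffler with parameter `α`: for all `r ≥ 0` its
`r`-th moment exists and equals `r! / Γ(r α + 1)`. -/
def IsMittagLeffler (α : ℝ) (ν : Measure ℝ) : Prop :=
  ∀ r : ℕ, Integrable (fun x : ℝ => x ^ r) ν ∧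
    ∫ x, x ^ r ∂ν = (r.factorial : ℝ) / Real.Gamma (r * α + 1)

/-!
The length of the leftmost path and the degree of the source are Markov chains on `ℕ` of the same
kind. If the leftmost path consists of `k` of the `n` edges, then it grows by one edge exactly when
one of these `k` edges is doubled in a serial way, which has probability `(1 - p) * k / n`; a
parallel doubling inserts its new edge to the right and leaves the path alone. If `k` of the `n`
edges leave the source, then the degree of the source grows exactly when one of these is doubled in
a parallel way, which has probability `p * k / n`. So the length and the degree both follow the law
`growthLaw a n`, with `a = 1 - p` and `a = p` respectively (`map_leftmostLength`,
`map_sourceDegree`), and exchanging `p` and `1 - p` exchanges the two laws. The combinatorial input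
is that the networks stay well-formed (`SPNetwork.WellFormed`), so that the sets of counted edges
are identified by their labels.

The alternating sum for the point probabilities solves the forward equation of this chain
(`toReal_growthLaw_apply`).

For the limit law, the rising factorials `k (k + 1) ⋯ (k + r - 1)` are eigenfunctions of the chain:
one step multiplies their expectation by `1 + a * r / n`. Hence the expectation at time `n` is a
product which, by Euler's formula for the Gamma function, is asymptotically
`r! / Γ(r a + 1) * n ^ (r a)`, and the `r`-th power has the same asymptotics
(`tendsto_integral_pow_growthLaw`). The conclusion follows by the method of moments
(`exists_tendsto_of_tendsto_moments`): bounded moments give tightness, every weak limit point has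
the limiting moments, and these determine the distribution. The last point holds because the `r`-th
moment is `O(r!)`, so that the complex moment generating function is analytic in a strip around the
imaginary axis and determined there by its Taylor series at `0`
(`MeasureTheory.Measure.ext_of_integral_pow_eq`).
-/

open scoped Topology

/-! ### Leftmost paths and source degrees under doubling -/

/-- Insert `n` directly after every occurrence of `j`. Both kinds of doubling act in this way on the
list of all edge labels; serial doubling acts in this way on the labels along the leftmost path, and
parallel doubling on the labels of the edges at the source. -/
def insertAfter (j n : ℕ) (l : List ℕ) : List ℕ :=
  l.flatMap fun i => if i = j then [i, n] else [i]

lemma mem_insertAfter {j n i : ℕ} {l : List ℕ} (h : i ∈ insertAfter j n l) : i ∈ l ∨ i = n := by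
  simp only [insertAfter, List.mem_flatMap] at h
  obtain ⟨k, hk, h⟩ := h
  split_ifs at h <;> simp at h <;> grind

lemma nodup_insertAfter {j n : ℕ} {l : List ℕ} (hl : l.Nodup) (hn : n ∉ l) :
    (insertAfter j n l).Nodup := by
  induction l with
  | nil => simp [insertAfter]
  | cons i l ih =>
    have hl' := List.nodup_cons.1 hl
    have ih' := ih hl'.2 (fun h => hn (List.mem_cons_of_mem _ h))
    have e : insertAfter j n (i :: l) =
        (if i = j then [i, n] else [i]) ++ insertAfter j n l := rfl
    have hi : i ∉ insertAfter j n l := by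
      intro h
      rcases mem_insertAfter h with h | h
      · exact hl'.1 h
      · exact hn (by simp [h])
    rw [e]
    split_ifs with hij
    · have hn' : n ∉ insertAfter j n l := by
        have : insertAfter j n l = l := by
          subst hij
          rw [insertAfter, List.flatMap_congr (g := fun k => [k])]
          · simp
          · intro k hk
            have : k ≠ i := fun h => hl'.1 (h ▸ hk)
            simp [this]
        rw [this]
        exact fun h => hn (List.mem_cons_of_mem _ h)
      have : i ≠ n := fun h => hn (by simp [h])
      simp [hi, hn', ih', this]
    · simp [hi, ih']

lemma length_insertAfter {j n : ℕ} {l : List ℕ} (hl : l.Nodup) :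
    (insertAfter j n l).length = if j ∈ l then l.length + 1 else l.length := by
  induction l with
  | nil => simp [insertAfter]
  | cons i l ih =>
    have hl' := List.nodup_cons.1 hl
    have e : insertAfter j n (i :: l) =
        (if i = j then [i, n] else [i]) ++ insertAfter j n l := rfl
    rw [e, List.length_append, ih hl'.2]
    by_cases hij : i = j
    · subst hij
      simp [hl'.1]; omega
    · have : j ≠ i := Ne.symm hij
      simp only [hij, if_false, List.mem_cons, this, false_or, List.length_cons, List.length_nil]
      split_ifs <;> omega

namespace SPNetwork

/-- `G.IsLeftmostPath v l`: the walk that starts at the node `v` and always takes the leftmost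
outgoing edge traverses edges with the labels `l` up to its first visit to the sink. -/
def IsLeftmostPath (G : SPNetwork) : ℕ → List ℕ → Prop
  | v, [] => v = 1
  | v, j :: l => v ≠ 1 ∧ ∃ e : SPEdge, (G.edges.find? fun e => e.tail = v) = some e ∧
      e.label = j ∧ G.IsLeftmostPath e.head l

lemma IsLeftmostPath.iterate {G : SPNetwork} {v : ℕ} {l : List ℕ} (h : G.IsLeftmostPath v l) :
    G.leftmostStep^[l.length] v = 1 ∧ ∀ k < l.length, G.leftmostStep^[k] v ≠ 1 := by
  induction l generalizing v with
  | nil => simpa [IsLeftmostPath] using h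
  | cons j l ih =>
    obtain ⟨hv, e, he, -, hp⟩ := h
    have hs : G.leftmostStep v = e.head := by simp only [leftmostStep, he]
    obtain ⟨h1, h2⟩ := ih hp
    refine ⟨by simpa [hs] using h1, fun k hk => ?_⟩
    cases k with
    | zero => simpa using hv
    | succ k => simpa [hs] using h2 k (by simpa using hk)

lemma IsLeftmostPath.leftmostLength_eq {G : SPNetwork} {l : List ℕ} (h : G.IsLeftmostPath 0 l) :
    G.leftmostLength = l.length := by
  obtain ⟨h1, h2⟩ := h.iterate
  refine le_antisymm (Nat.sInf_le h1) (le_csInf ⟨_, h1⟩ fun k hk => ?_)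
  by_contra! hlt
  exact h2 k hlt hk

lemma IsLeftmostPath.mem_labels {G : SPNetwork} {v : ℕ} {l : List ℕ} (h : G.IsLeftmostPath v l) :
    ∀ i ∈ l, i ∈ G.edges.map SPEdge.label := by
  induction l generalizing v with
  | nil => simp
  | cons j l ih =>
    obtain ⟨-, e, he, hj, hp⟩ := h
    intro i hi
    rcases List.mem_cons.1 hi with rfl | hi
    · exact List.mem_map.2 ⟨e, List.mem_of_find?_eq_some he, hj⟩
    · exact ih hp i hi

/-- The labels of the edges at the source. -/
def sourceLabels (G : SPNetwork) : List ℕ :=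
  (G.edges.filter fun e => e.tail = 0 ∨ e.head = 0).map SPEdge.label

lemma length_sourceLabels (G : SPNetwork) : G.sourceLabels.length = G.sourceDegree := by
  simp [sourceLabels, sourceDegree, List.countP_eq_length_filter]

/-- The properties of the networks of size `n` on which the growth of the leftmost path and of the
source degree depends: the edge labels are distinct elements of `{1, …, n}`, the nodes are numbered
below `nodeCount`, no edge enters the source, and the leftmost walk from the source reaches the sink
without repeating an edge. -/
structure WellFormed (G : SPNetwork) (n : ℕ) : Prop where
  nodup : (G.edges.map SPEdge.label).Nodup
  label_mem : ∀ i ∈ G.edges.map SPEdge.label, i ∈ Finset.Icc 1 n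
  two_le : 2 ≤ G.nodeCount
  tail_lt : ∀ e ∈ G.edges, e.tail < G.nodeCount
  head_lt : ∀ e ∈ G.edges, e.head < G.nodeCount
  head_ne : ∀ e ∈ G.edges, e.head ≠ 0
  path : ∃ l, G.IsLeftmostPath 0 l ∧ l.Nodup

lemma wellFormed_initial : initial.WellFormed 1 where
  nodup := by simp [initial]
  label_mem := by simp [initial]
  two_le := le_rfl
  tail_lt := by simp [initial]
  head_lt := by simp [initial]
  head_ne := by simp [initial]
  path := ⟨[1], by simp [IsLeftmostPath, initial], by simp⟩

lemma leftmostLength_initial : initial.leftmostLength = 1 := by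
  have : initial.IsLeftmostPath 0 [1] := by simp [IsLeftmostPath, initial]
  exact this.leftmostLength_eq

lemma sourceDegree_initial : initial.sourceDegree = 1 := by
  simp [initial, sourceDegree]

lemma map_label_parallel (G : SPNetwork) (j n : ℕ) :
    (G.parallel j n).edges.map SPEdge.label = insertAfter j n (G.edges.map SPEdge.label) := by
  simp only [parallel, insertAfter, List.map_flatMap, List.flatMap_map]
  congr 1
  ext1 e
  split_ifs <;> simp

lemma map_label_serial (G : SPNetwork) (j n : ℕ) :
    (G.serial j n).edges.map SPEdge.label = insertAfter j n (G.edges.map SPEdge.label) := by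
  simp only [serial, insertAfter, List.map_flatMap, List.flatMap_map]
  congr 1
  ext1 e
  split_ifs with h <;> simp [h]

lemma find?_parallel (G : SPNetwork) (j n v : ℕ) :
    ((G.parallel j n).edges.find? fun e => e.tail = v) = G.edges.find? fun e => e.tail = v := by
  simp only [parallel]
  induction G.edges with
  | nil => rfl
  | cons e l ih =>
    rw [List.flatMap_cons, List.find?_append, ih, List.find?_cons]
    by_cases hv : e.tail = v <;> split_ifs <;> simp [hv]

/-- An old node keeps its leftmost outgoing edge under serial doubling, except that the doubled edge
now leads to the new node. -/
lemma find?_serial_of_ne (G : SPNetwork) (j n : ℕ) {v : ℕ} (hv : v ≠ G.nodeCount) :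
    ((G.serial j n).edges.find? fun e => e.tail = v) =
      (G.edges.find? fun e => e.tail = v).map fun e =>
        if e.label = j then ⟨j, e.tail, G.nodeCount⟩ else e := by
  simp only [serial]
  induction G.edges with
  | nil => rfl
  | cons e l ih =>
    rw [List.flatMap_cons, List.find?_append, ih, List.find?_cons]
    by_cases hv' : e.tail = v <;> split_ifs with hj <;> simp [hv', hj, hv.symm]

/-- The new node has a single outgoing edge, since only one edge carries the label of the doubled
one. -/
lemma find?_serial_nodeCount (G : SPNetwork) (n : ℕ) {e : SPEdge} (he : e ∈ G.edges)
    (hnodup : (G.edges.map SPEdge.label).Nodup) (htail : ∀ e ∈ G.edges, e.tail < G.nodeCount) :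
    ((G.serial e.label n).edges.find? fun e' => e'.tail = G.nodeCount) =
      some ⟨n, G.nodeCount, e.head⟩ := by
  simp only [serial]
  have huniq : ∀ e' ∈ G.edges, e'.label = e.label → e' = e := fun e' he' h =>
    List.inj_on_of_nodup_map hnodup he' he h
  clear hnodup
  generalize G.edges = L at *
  induction L with
  | nil => simp at he
  | cons a l ih =>
    have ha : a.tail ≠ G.nodeCount := (htail a (by simp)).ne
    rw [List.flatMap_cons, List.find?_append]
    by_cases hj : a.label = e.label
    · have := huniq a (by simp) hj
      subst this
      simp [ha]
    · have hel : e ∈ l := by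
        rcases List.mem_cons.1 he with rfl | h
        · exact absurd rfl hj
        · exact h
      rw [ih hel (fun e' h => htail e' (List.mem_cons_of_mem _ h))
        (fun e' h => huniq e' (List.mem_cons_of_mem _ h))]
      simp [hj, ha]

lemma IsLeftmostPath.parallel {G : SPNetwork} {v : ℕ} {l : List ℕ} (h : G.IsLeftmostPath v l)
    (j n : ℕ) : (G.parallel j n).IsLeftmostPath v l := by
  induction l generalizing v with
  | nil => exact h
  | cons i l ih =>
    obtain ⟨hv, e, he, hj, hp⟩ := h
    exact ⟨hv, e, by rw [find?_parallel, he], hj, ih hp⟩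

lemma IsLeftmostPath.serial {G : SPNetwork} {m : ℕ} (hG : G.WellFormed m) {v : ℕ} {l : List ℕ}
    (h : G.IsLeftmostPath v l) (hv : v < G.nodeCount) (j n : ℕ) :
    (G.serial j n).IsLeftmostPath v (insertAfter j n l) := by
  induction l generalizing v with
  | nil => exact h
  | cons i l ih =>
    obtain ⟨hv1, e, he, hi, hp⟩ := h
    have hmem := List.mem_of_find?_eq_some he
    have ih' := ih hp (hG.head_lt e hmem)
    have hfind := find?_serial_of_ne G j n hv.ne
    rw [he, Option.map_some] at hfind
    have e' : insertAfter j n (i :: l) =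
        (if i = j then [i, n] else [i]) ++ insertAfter j n l := rfl
    rw [e']
    -- the walk makes a detour through the new node exactly when it uses the doubled edge
    by_cases hij : i = j
    · have hN : G.nodeCount ≠ 1 := by have := hG.two_le; omega
      have hej : e.label = j := hi.trans hij
      rw [if_pos hij]
      rw [if_pos hej] at hfind
      refine ⟨hv1, _, hfind, hij.symm, hN, ⟨n, G.nodeCount, e.head⟩, ?_, rfl, ih'⟩
      subst hej
      exact find?_serial_nodeCount G n hmem hG.nodup hG.tail_lt
    · have hej : e.label ≠ j := fun h => hij (hi.symm.trans h)
      rw [if_neg hij]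
      rw [if_neg hej] at hfind
      exact ⟨hv1, e, hfind, hi, ih'⟩

lemma WellFormed.succ_notMem {G : SPNetwork} {n : ℕ} (hG : G.WellFormed n) :
    n + 1 ∉ G.edges.map SPEdge.label := fun h => by
  have := Finset.mem_Icc.1 (hG.label_mem _ h)
  omega

lemma WellFormed.parallel {G : SPNetwork} {n : ℕ} (hG : G.WellFormed n) (j : ℕ) :
    (G.parallel j (n + 1)).WellFormed (n + 1) where
  nodup := by
    rw [map_label_parallel]
    exact nodup_insertAfter hG.nodup hG.succ_notMem
  label_mem i hi := by
    rw [map_label_parallel] at hi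
    rcases mem_insertAfter hi with h | rfl
    · have := Finset.mem_Icc.1 (hG.label_mem _ h)
      exact Finset.mem_Icc.2 ⟨this.1, by omega⟩
    · simp
  two_le := hG.two_le
  tail_lt e he := by
    simp only [SPNetwork.parallel, List.mem_flatMap] at he ⊢
    obtain ⟨a, ha, he⟩ := he
    have := hG.tail_lt a ha
    split_ifs at he <;> simp at he <;> grind
  head_lt e he := by
    simp only [SPNetwork.parallel, List.mem_flatMap] at he ⊢
    obtain ⟨a, ha, he⟩ := he
    have := hG.head_lt a ha
    split_ifs at he <;> simp at he <;> grind
  head_ne e he := by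
    simp only [SPNetwork.parallel, List.mem_flatMap] at he ⊢
    obtain ⟨a, ha, he⟩ := he
    have := hG.head_ne a ha
    split_ifs at he <;> simp at he <;> grind
  path := by
    obtain ⟨l, hl, hd⟩ := hG.path
    exact ⟨l, hl.parallel j _, hd⟩

lemma WellFormed.serial {G : SPNetwork} {n : ℕ} (hG : G.WellFormed n) (j : ℕ) :
    (G.serial j (n + 1)).WellFormed (n + 1) where
  nodup := by
    rw [map_label_serial]
    exact nodup_insertAfter hG.nodup hG.succ_notMem
  label_mem i hi := by
    rw [map_label_serial] at hi
    rcases mem_insertAfter hi with h | rfl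
    · have := Finset.mem_Icc.1 (hG.label_mem _ h)
      exact Finset.mem_Icc.2 ⟨this.1, by omega⟩
    · simp
  two_le := hG.two_le.trans (Nat.le_succ _)
  tail_lt e he := by
    simp only [SPNetwork.serial, List.mem_flatMap] at he ⊢
    obtain ⟨a, ha, he⟩ := he
    have := hG.tail_lt a ha
    split_ifs at he <;> simp at he <;> grind
  head_lt e he := by
    simp only [SPNetwork.serial, List.mem_flatMap] at he ⊢
    obtain ⟨a, ha, he⟩ := he
    have := hG.head_lt a ha
    split_ifs at he <;> simp at he <;> grind
  head_ne e he := by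
    simp only [SPNetwork.serial, List.mem_flatMap] at he ⊢
    obtain ⟨a, ha, he⟩ := he
    have := hG.head_ne a ha
    have := hG.two_le
    split_ifs at he <;> simp at he <;> grind
  path := by
    obtain ⟨l, hl, hd⟩ := hG.path
    exact ⟨_, hl.serial hG (by have := hG.two_le; omega) j _,
      nodup_insertAfter hd fun h => hG.succ_notMem (hl.mem_labels _ h)⟩

/-- The leftmost path grows by one exactly when one of its edges is doubled in a serial way. -/
lemma WellFormed.leftmostLength_step {G : SPNetwork} {n : ℕ} (hG : G.WellFormed n) :
    ∃ S ⊆ Finset.Icc 1 n, S.card = G.leftmostLength ∧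
      (∀ j, (G.parallel j (n + 1)).leftmostLength = G.leftmostLength) ∧
      ∀ j, (G.serial j (n + 1)).leftmostLength =
        if j ∈ S then G.leftmostLength + 1 else G.leftmostLength := by
  obtain ⟨l, hl, hd⟩ := hG.path
  refine ⟨l.toFinset, fun i hi => hG.label_mem i (hl.mem_labels i (List.mem_toFinset.1 hi)), ?_,
    fun j => ?_, fun j => ?_⟩
  · rw [List.toFinset_card_of_nodup hd, hl.leftmostLength_eq]
  · rw [(hl.parallel j _).leftmostLength_eq, hl.leftmostLength_eq]
  · rw [(hl.serial hG (by have := hG.two_le; omega) j _).leftmostLength_eq, hl.leftmostLength_eq,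
      length_insertAfter hd]
    simp

lemma sourceLabels_parallel (G : SPNetwork) (j n : ℕ) :
    (G.parallel j n).sourceLabels = insertAfter j n G.sourceLabels := by
  simp only [sourceLabels, parallel, insertAfter]
  induction G.edges with
  | nil => rfl
  | cons e l ih =>
    rw [List.flatMap_cons, List.filter_append, List.map_append, ih, List.filter_cons]
    by_cases hv : e.tail = 0 ∨ e.head = 0 <;> by_cases hj : e.label = j <;> simp [hv, hj]

lemma WellFormed.sourceLabels_serial {G : SPNetwork} {m : ℕ} (hG : G.WellFormed m) (j n : ℕ) :
    (G.serial j n).sourceLabels = G.sourceLabels := by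
  have hN : G.nodeCount ≠ 0 := by have := hG.two_le; omega
  have hh := hG.head_ne
  simp only [sourceLabels, SPNetwork.serial]
  generalize G.edges = L at *
  induction L with
  | nil => rfl
  | cons e l ih =>
    have he : e.head ≠ 0 := hh e (by simp)
    rw [List.flatMap_cons, List.filter_append, List.map_append,
      ih fun e' h => hh e' (List.mem_cons_of_mem _ h), List.filter_cons]
    by_cases hv : e.tail = 0 <;> by_cases hj : e.label = j <;> simp [hv, hj, he, hN]

/-- The source degree grows by one exactly when an edge at the source is doubled in a parallel
way. -/
lemma WellFormed.sourceDegree_step {G : SPNetwork} {n : ℕ} (hG : G.WellFormed n) :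
    ∃ S ⊆ Finset.Icc 1 n, S.card = G.sourceDegree ∧
      (∀ j, (G.serial j (n + 1)).sourceDegree = G.sourceDegree) ∧
      ∀ j, (G.parallel j (n + 1)).sourceDegree =
        if j ∈ S then G.sourceDegree + 1 else G.sourceDegree := by
  have hsub : G.sourceLabels.Sublist (G.edges.map SPEdge.label) := List.filter_sublist.map _
  have hd : G.sourceLabels.Nodup := hG.nodup.sublist hsub
  refine ⟨G.sourceLabels.toFinset,
    fun i hi => hG.label_mem i (hsub.subset (List.mem_toFinset.1 hi)), ?_, fun j => ?_, fun j => ?_⟩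
  · rw [List.toFinset_card_of_nodup hd, length_sourceLabels]
  · rw [← length_sourceLabels, hG.sourceLabels_serial, length_sourceLabels]
  · rw [← length_sourceLabels, sourceLabels_parallel, length_insertAfter hd]
    simp [length_sourceLabels]

end SPNetwork

/-! ### The growth chain -/

lemma coin_true (p : I) : coin p true = ENNReal.ofReal p := by
  simp [coin, PMF.ofFintype_apply]

lemma coin_false (p : I) : coin p false = ENNReal.ofReal (1 - p) := by
  simp [coin, PMF.ofFintype_apply]

lemma PMF.ext_of_apply_true {p q : PMF Bool} (h : p true = q true) : p = q := by
  have hp := p.tsum_coe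
  have hq := q.tsum_coe
  rw [tsum_bool] at hp hq
  ext b
  cases b
  · rw [← hq, h] at hp
    exact (ENNReal.add_left_inj (q.apply_ne_top true)).1 hp
  · exact h

lemma coin_map_not (p : I) : (coin p).map (fun b => !b) = coin (σ p) := by
  apply PMF.ext_of_apply_true
  rw [PMF.map_apply, tsum_bool]
  simp [coin_true, coin_false]

/-- The law of a Markov chain on `ℕ` that starts with the value `1` at time `1` and that, being at
`k` at time `n`, moves to `k + 1` with probability `a * k / n` and stays at `k` otherwise. The
projection to the unit interval has no effect at the values `k ≤ n` that the chain can take. -/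
noncomputable def growthLaw (a : I) : ℕ → PMF ℕ
  | 0 => PMF.pure 1
  | 1 => PMF.pure 1
  | n + 2 =>
    (growthLaw a (n + 1)).bind fun k =>
      (coin (a * Set.projIcc (0 : ℝ) 1 zero_le_one ((k : ℝ) / ((n + 1 : ℕ) : ℝ)))).map fun b =>
        if b then k + 1 else k

/-- Choosing a uniform `j ∈ {1, …, N}` and tossing an independent coin, the event that `j` lies in a
given set of size `k` and that the coin shows `true` is the event that a coin with success
probability `a * k / N` shows `true`. -/
lemma uniform_bind_coin (a : I) {N : ℕ} (h : (Finset.Icc 1 N).Nonempty) {S : Finset ℕ}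
    (hS : S ⊆ Finset.Icc 1 N) :
    ((PMF.uniformOfFinset (Finset.Icc 1 N) h).bind fun j =>
        (coin a).map fun b => b && decide (j ∈ S)) =
      coin (a * Set.projIcc (0 : ℝ) 1 zero_le_one ((S.card : ℝ) / (N : ℝ))) := by
  apply PMF.ext_of_apply_true
  have hN : 0 < N := by
    obtain ⟨x, hx⟩ := h
    have := Finset.mem_Icc.1 hx
    omega
  have hcard : S.card ≤ N := by simpa using Finset.card_le_card hS
  have hmem : (S.card : ℝ) / N ∈ Set.Icc (0 : ℝ) 1 :=
    ⟨by positivity, div_le_one_of_le₀ (by exact_mod_cast hcard) (by positivity)⟩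
  have h1 : ∀ j, ((coin a).map fun b => b && decide (j ∈ S)) true =
      if j ∈ S then ENNReal.ofReal a else 0 := by
    intro j
    rw [PMF.map_apply, tsum_bool]
    by_cases hj : j ∈ S <;> simp [hj, coin_true]
  rw [PMF.bind_apply, coin_true, Set.projIcc_of_mem _ hmem]
  simp_rw [h1, PMF.uniformOfFinset_apply]
  rw [tsum_eq_sum (s := S)]
  · trans ∑ j ∈ S, (N : ENNReal)⁻¹ * ENNReal.ofReal a
    · refine Finset.sum_congr rfl fun j hj => ?_
      rw [if_pos (hS hj), if_pos hj]
      simp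
    rw [Finset.sum_const, nsmul_eq_mul]
    have hN' : (0 : ℝ) < N := by exact_mod_cast hN
    rw [Set.Icc.coe_mul, ENNReal.ofReal_mul a.2.1, ENNReal.ofReal_div_of_pos hN',
      ENNReal.ofReal_natCast, ENNReal.ofReal_natCast, div_eq_mul_inv]
    ring
  · intro j hj
    simp [hj]

lemma PMF.bind_congr_of_mem_support {α β : Type*} {p : PMF α} {f g : α → PMF β}
    (h : ∀ x ∈ p.support, f x = g x) : p.bind f = p.bind g := by
  ext y
  simp only [PMF.bind_apply]
  refine tsum_congr fun x => ?_
  by_cases hx : p x = 0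
  · simp [hx]
  · rw [h x ((p.mem_support_iff x).2 hx)]

lemma wellFormed_of_mem_support (p : I) (n : ℕ) :
    ∀ G ∈ (bernoulliNetwork p (n + 1)).support, G.WellFormed (n + 1) := by
  induction n with
  | zero =>
    intro G hG
    rw [show bernoulliNetwork p (0 + 1) = PMF.pure SPNetwork.initial from rfl,
      PMF.support_pure] at hG
    rw [Set.mem_singleton_iff.1 hG]
    exact SPNetwork.wellFormed_initial
  | succ n ih =>
    intro G hG
    rw [bernoulliNetwork, PMF.mem_support_bind_iff] at hG
    obtain ⟨G', hG', hG⟩ := hG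
    rw [PMF.mem_support_bind_iff] at hG
    obtain ⟨j, -, hG⟩ := hG
    rw [PMF.mem_support_map_iff] at hG
    obtain ⟨b, -, rfl⟩ := hG
    cases b
    · exact (ih G' hG').serial j
    · exact (ih G' hG').parallel j

/-- A statistic that starts at `1` and that grows by one exactly when one of the edges which it
counts is doubled in the way selected by `flip` is distributed as the growth chain. -/
lemma map_bernoulliNetwork_eq_growthLaw {p a : I} {flip : Bool → Bool}
    (hflip : (coin p).map flip = coin a) {f : SPNetwork → ℕ} (hinit : f SPNetwork.initial = 1)
    (hstep : ∀ (G : SPNetwork) (n : ℕ), G.WellFormed n → ∃ S ⊆ Finset.Icc 1 n, S.card = f G ∧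
      ∀ j b, f (if b then G.parallel j (n + 1) else G.serial j (n + 1)) =
        if flip b && decide (j ∈ S) then f G + 1 else f G) (n : ℕ) :
    (bernoulliNetwork p n).map f = growthLaw a n := by
  have h1 : (PMF.pure SPNetwork.initial).map f = PMF.pure 1 := by rw [PMF.pure_map, hinit]
  cases n with
  | zero => exact h1
  | succ n =>
    induction n with
    | zero => exact h1
    | succ n ih =>
      rw [growthLaw, ← ih, PMF.bind_map, bernoulliNetwork, PMF.map_bind]
      apply PMF.bind_congr_of_mem_support
      intro G hG
      obtain ⟨S, hS, hcard, hj⟩ := hstep G _ (wellFormed_of_mem_support p n G hG)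
      have hu := uniform_bind_coin a ⟨1, by simp⟩ hS
      rw [Function.comp_apply, ← hcard, ← hu, PMF.map_bind, PMF.map_bind, hcard]
      congr 1
      ext1 j
      rw [PMF.map_comp, PMF.map_comp, ← hflip, PMF.map_comp]
      congr 1
      ext1 b
      exact hj j b

lemma map_leftmostLength (p : I) (n : ℕ) :
    (bernoulliNetwork p n).map SPNetwork.leftmostLength = growthLaw (σ p) n := by
  refine map_bernoulliNetwork_eq_growthLaw (coin_map_not p) SPNetwork.leftmostLength_initial
    (fun G n hG => ?_) n
  obtain ⟨S, hS, hc, hpar, hser⟩ := hG.leftmostLength_step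
  refine ⟨S, hS, hc, fun j b => ?_⟩
  cases b
  · simp [hser]
  · simp [hpar]

lemma map_sourceDegree (p : I) (n : ℕ) :
    (bernoulliNetwork p n).map SPNetwork.sourceDegree = growthLaw p n := by
  refine map_bernoulliNetwork_eq_growthLaw (flip := id) (PMF.map_id _)
    SPNetwork.sourceDegree_initial (fun G n hG => ?_) n
  obtain ⟨S, hS, hc, hser, hpar⟩ := hG.sourceDegree_step
  refine ⟨S, hS, hc, fun j b => ?_⟩
  cases b
  · simp [hser]
  · simp [hpar]

lemma map_toMeasure_leftmostLength (p : I) (n : ℕ) :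
    (bernoulliNetwork p n).toMeasure.map SPNetwork.leftmostLength =
      (growthLaw (σ p) n).toMeasure := by
  rw [PMF.toMeasure_map _ _ measurable_from_top, map_leftmostLength]

lemma map_toMeasure_sourceDegree (p : I) (n : ℕ) :
    (bernoulliNetwork p n).toMeasure.map SPNetwork.sourceDegree = (growthLaw p n).toMeasure := by
  rw [PMF.toMeasure_map _ _ measurable_from_top, map_sourceDegree]

/-! ### Point probabilities of the growth chain -/

lemma growthLaw_apply_eq_zero_of_lt (a : I) (n : ℕ) {m : ℕ} (hm : n + 1 < m) :
    growthLaw a (n + 1) m = 0 := by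
  induction n generalizing m with
  | zero =>
    rw [growthLaw, PMF.pure_apply, if_neg (by omega)]
  | succ n ih =>
    rw [growthLaw, PMF.bind_apply, ENNReal.tsum_eq_zero]
    intro k
    rcases lt_or_ge (n + 1) k with hk | hk
    · rw [ih hk, zero_mul]
    · rw [PMF.map_apply, tsum_bool]
      simp [show m ≠ k by omega, show m ≠ k + 1 by omega]

lemma growthLaw_apply_zero (a : I) (n : ℕ) : growthLaw a (n + 1) 0 = 0 := by
  induction n with
  | zero => rw [growthLaw, PMF.pure_apply, if_neg (by omega)]
  | succ n ih =>
    rw [growthLaw, PMF.bind_apply, ENNReal.tsum_eq_zero]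
    intro k
    cases k with
    | zero => rw [ih, zero_mul]
    | succ k => rw [PMF.map_apply, tsum_bool]; simp

/-- The forward equation of the growth chain. -/
lemma toReal_growthLaw_succ (a : I) (n m : ℕ) :
    (growthLaw a (n + 2) (m + 1)).toReal =
      (1 - a * (m + 1 : ℕ) / (n + 1 : ℕ)) * (growthLaw a (n + 1) (m + 1)).toReal +
        a * m / (n + 1 : ℕ) * (growthLaw a (n + 1) m).toReal := by
  have h1 : growthLaw a (n + 2) (m + 1) =
      growthLaw a (n + 1) m * coin (a * Set.projIcc (0 : ℝ) 1 zero_le_one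
        ((m : ℝ) / ((n + 1 : ℕ) : ℝ))) true +
      growthLaw a (n + 1) (m + 1) * coin (a * Set.projIcc (0 : ℝ) 1 zero_le_one
        (((m + 1 : ℕ) : ℝ) / ((n + 1 : ℕ) : ℝ))) false := by
    rw [growthLaw, PMF.bind_apply, tsum_eq_sum (s := {m, m + 1}), Finset.sum_pair (by omega)]
    · simp only [PMF.map_apply, tsum_bool]
      simp
    · intro k hk
      simp only [Finset.mem_insert, Finset.mem_singleton, not_or] at hk
      rw [PMF.map_apply, tsum_bool]
      simp [show m + 1 ≠ k by omega, show m ≠ k by omega]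
  have h2 : ∀ k : ℕ, growthLaw a (n + 1) k ≠ 0 →
      ((a * Set.projIcc (0 : ℝ) 1 zero_le_one ((k : ℝ) / ((n + 1 : ℕ) : ℝ)) : I) : ℝ) =
        a * k / (n + 1 : ℕ) := by
    intro k hk
    have hkn : k ≤ n + 1 := by
      by_contra! h
      exact hk (growthLaw_apply_eq_zero_of_lt a n h)
    have hmem : (k : ℝ) / ((n + 1 : ℕ) : ℝ) ∈ Set.Icc (0 : ℝ) 1 :=
      ⟨by positivity, div_le_one_of_le₀ (by exact_mod_cast hkn) (by positivity)⟩
    rw [Set.projIcc_of_mem _ hmem, Set.Icc.coe_mul, mul_div_assoc]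
  have h3 : ∀ k : ℕ, (growthLaw a (n + 1) k * coin (a * Set.projIcc (0 : ℝ) 1 zero_le_one
        ((k : ℝ) / ((n + 1 : ℕ) : ℝ))) true).toReal =
      a * k / (n + 1 : ℕ) * (growthLaw a (n + 1) k).toReal := by
    intro k
    by_cases hk : growthLaw a (n + 1) k = 0
    · simp [hk]
    · rw [ENNReal.toReal_mul, coin_true, ENNReal.toReal_ofReal (a * _ : I).2.1, h2 k hk, mul_comm]
  have h4 : ∀ k : ℕ, (growthLaw a (n + 1) k * coin (a * Set.projIcc (0 : ℝ) 1 zero_le_one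
        ((k : ℝ) / ((n + 1 : ℕ) : ℝ))) false).toReal =
      (1 - a * k / (n + 1 : ℕ)) * (growthLaw a (n + 1) k).toReal := by
    intro k
    by_cases hk : growthLaw a (n + 1) k = 0
    · simp [hk]
    · rw [ENNReal.toReal_mul, coin_false,
        ENNReal.toReal_ofReal (sub_nonneg.2 (a * _ : I).2.2), h2 k hk, mul_comm]
  rw [h1, ENNReal.toReal_add (ENNReal.mul_ne_top (PMF.apply_ne_top _ _) (PMF.apply_ne_top _ _))
    (ENNReal.mul_ne_top (PMF.apply_ne_top _ _) (PMF.apply_ne_top _ _)), h3, h4, add_comm]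

/-- Absorption of the factor `x - n` into a generalized binomial coefficient. -/
lemma Ring.choose_succ_mul (x : ℝ) (n : ℕ) :
    Ring.choose x (n + 1) * (n + 1) = Ring.choose x n * (x - n) := by
  have h := Ring.choose_smul_choose x (Nat.le_succ n)
  rw [Nat.choose_succ_self_right, Nat.succ_eq_add_one, nsmul_eq_mul, Nat.add_sub_cancel_left,
    Ring.choose_one_right] at h
  rw [← h]
  push_cast
  ring

/-- The alternating sum solves the forward equation because each of its terms does so up to
multiples of binomial coefficients that cancel by the absorption identity. -/
theorem toReal_growthLaw_apply (a : I) (n m : ℕ) :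
    (growthLaw a (n + 1) (m + 1)).toReal =
      ∑ j ∈ Finset.range (m + 1), (m.choose j : ℝ) * (-1) ^ (n + j) *
        Ring.choose ((a : ℝ) * (j + 1) - 1) n := by
  induction n generalizing m with
  | zero =>
    have h := Int.alternating_sum_range_choose (n := m)
    have h' := congrArg (Int.cast : ℤ → ℝ) h
    push_cast at h'
    rw [growthLaw, PMF.pure_apply]
    simp only [Ring.choose_zero_right, mul_one, zero_add]
    simp_rw [mul_comm (Nat.cast (m.choose _) : ℝ)]
    rw [h']
    by_cases hm : m = 0 <;> simp [hm]
  | succ n ih =>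
    rw [toReal_growthLaw_succ, ih]
    -- absorption turns the sum at `m - 1` into one with the binomial coefficients of `m`
    have hprev : (m : ℝ) * (growthLaw a (n + 1) m).toReal =
        ∑ j ∈ Finset.range (m + 1), ((m : ℝ) - j) * (m.choose j : ℝ) * (-1) ^ (n + j) *
          Ring.choose ((a : ℝ) * (j + 1) - 1) n := by
      cases m with
      | zero => simp
      | succ m =>
        rw [ih, Finset.sum_range_succ _ (m + 1), Finset.mul_sum]
        simp only [sub_self, zero_mul, add_zero]
        refine Finset.sum_congr rfl fun j hj => ?_
        have hjm : j ≤ m := Nat.lt_succ_iff.1 (Finset.mem_range.1 hj)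
        have h := congrArg (Nat.cast : ℕ → ℝ) (Nat.choose_mul_succ_eq m j)
        push_cast [Nat.cast_sub (show j ≤ m + 1 by omega)] at h
        push_cast
        linear_combination (-1 : ℝ) ^ (n + j) * Ring.choose ((a : ℝ) * (j + 1) - 1) n * h
    have hn : ((n + 1 : ℕ) : ℝ) ≠ 0 := by positivity
    have e : (a : ℝ) * m / (n + 1 : ℕ) * (growthLaw a (n + 1) m).toReal =
        a / (n + 1 : ℕ) * (m * (growthLaw a (n + 1) m).toReal) := by ring
    rw [e, hprev, Finset.mul_sum, Finset.mul_sum, ← Finset.sum_add_distrib]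
    refine Finset.sum_congr rfl fun j _ => ?_
    have hc : Ring.choose ((a : ℝ) * (j + 1) - 1) (n + 1) =
        Ring.choose ((a : ℝ) * (j + 1) - 1) n * (a * (j + 1) - 1 - n) / (n + 1 : ℕ) := by
      rw [eq_div_iff hn, ← Ring.choose_succ_mul]
      push_cast
      ring
    rw [hc]
    field_simp
    push_cast
    ring

/-! ### The method of moments -/

lemma abs_pow_le_one_add_pow_two_mul (x : ℝ) (r : ℕ) : |x ^ r| ≤ 1 + x ^ (2 * r) := by
  have h : x ^ (2 * r) = |x ^ r| ^ 2 := by rw [sq_abs, ← pow_mul, mul_comm]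
  rw [h]
  nlinarith [sq_nonneg (|x ^ r| - 1), abs_nonneg (x ^ r)]

lemma integrable_pow_of_integrable_pow_two_mul {μ : Measure ℝ} [IsFiniteMeasure μ] {r : ℕ}
    (h : Integrable (fun x : ℝ => x ^ (2 * r)) μ) : Integrable (fun x : ℝ => x ^ r) μ := by
  refine ((integrable_const (1 : ℝ)).add h).mono' (by fun_prop) (ae_of_all _ fun x => ?_)
  rw [Real.norm_eq_abs]
  exact abs_pow_le_one_add_pow_two_mul x r

lemma lintegral_pow_two_mul_le {μ : Measure ℝ} {s : ℕ}
    (hint : Integrable (fun x : ℝ => x ^ (2 * s)) μ) {C : ℝ} (hC : ∫ x, x ^ (2 * s) ∂μ ≤ C) :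
    ∫⁻ x, ENNReal.ofReal (x ^ (2 * s)) ∂μ ≤ ENNReal.ofReal C := by
  rw [← ofReal_integral_eq_lintegral_ofReal hint
    (ae_of_all _ fun x => (even_two_mul s).pow_nonneg x)]
  exact ENNReal.ofReal_le_ofReal hC

/-- Weak limits inherit bounds on even moments. -/
lemma integrable_pow_and_integral_le_of_tendsto {μ : ℕ → ProbabilityMeasure ℝ}
    {ν : ProbabilityMeasure ℝ} (hμ : Tendsto μ atTop (𝓝 ν)) {s : ℕ} {C : ℝ} (hC0 : 0 ≤ C)
    (hint : ∀ n, Integrable (fun x : ℝ => x ^ (2 * s)) (μ n : Measure ℝ))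
    (hC : ∀ n, ∫ x, x ^ (2 * s) ∂(μ n : Measure ℝ) ≤ C) :
    Integrable (fun x : ℝ => x ^ (2 * s)) (ν : Measure ℝ) ∧
      ∫ x, x ^ (2 * s) ∂(ν : Measure ℝ) ≤ C := by
  have hnn : ∀ x : ℝ, 0 ≤ x ^ (2 * s) := fun x => (even_two_mul s).pow_nonneg x
  have h1 : ∫⁻ x, ENNReal.ofReal (x ^ (2 * s)) ∂(ν : Measure ℝ) ≤ ENNReal.ofReal C := by
    refine (lintegral_le_liminf_lintegral_of_forall_isOpen_measure_le_liminf_measure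
      (μs := fun n => (μ n : Measure ℝ)) (f := fun x : ℝ => x ^ (2 * s)) (by fun_prop)
      (fun x => hnn x)
      (fun G hG => ProbabilityMeasure.le_liminf_measure_open_of_tendsto hμ hG)).trans ?_
    refine (liminf_le_liminf (v := fun _ => ENNReal.ofReal C) (Eventually.of_forall fun n =>
      lintegral_pow_two_mul_le (hint n) (hC n))).trans ?_
    simp
  have h2 : Integrable (fun x : ℝ => x ^ (2 * s)) (ν : Measure ℝ) := by
    refine ⟨by fun_prop, ?_⟩
    rw [hasFiniteIntegral_iff_ofReal (ae_of_all _ hnn)]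
    exact h1.trans_lt ENNReal.ofReal_lt_top
  refine ⟨h2, ?_⟩
  rw [← ofReal_integral_eq_lintegral_ofReal h2 (ae_of_all _ hnn)] at h1
  exact (ENNReal.ofReal_le_ofReal_iff hC0).1 h1

/-- The power function, truncated at the arguments `±K`. -/
noncomputable def truncatedPow (K : ℝ) (r : ℕ) (x : ℝ) : ℝ := (max (-K) (min x K)) ^ r

lemma continuous_truncatedPow (K : ℝ) (r : ℕ) : Continuous (truncatedPow K r) := by
  unfold truncatedPow
  fun_prop

lemma abs_truncatedPow_le {K : ℝ} (hK : 0 ≤ K) (r : ℕ) (x : ℝ) : |truncatedPow K r x| ≤ K ^ r := by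
  rw [truncatedPow, abs_pow]
  refine pow_le_pow_left₀ (abs_nonneg _) (abs_le.2 ⟨le_max_left _ _, ?_⟩) r
  exact max_le (by linarith) (min_le_right _ _)

lemma abs_pow_sub_truncatedPow_le {K : ℝ} (hK : 1 ≤ K) (r : ℕ) (x : ℝ) :
    |x ^ r - truncatedPow K r x| ≤ 2 / K * x ^ (2 * (r + 1)) := by
  have hK0 : 0 < K := by linarith
  have hnn : 0 ≤ x ^ (2 * (r + 1)) := (even_two_mul _).pow_nonneg x
  by_cases hx : |x| ≤ K
  · have h := abs_le.1 hx
    rw [truncatedPow, min_eq_left h.2, max_eq_right h.1, sub_self, abs_zero]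
    positivity
  · push Not at hx
    have h1 : |x ^ r| = |x| ^ r := abs_pow x r
    have h2 : |truncatedPow K r x| ≤ |x| ^ r :=
      (abs_truncatedPow_le hK0.le r x).trans (pow_le_pow_left₀ hK0.le hx.le r)
    have h3 : |x ^ r - truncatedPow K r x| ≤ 2 * |x| ^ r := by
      refine (abs_sub _ _).trans ?_
      linarith
    have h4 : x ^ (2 * (r + 1)) = |x| ^ (2 * (r + 1)) := ((even_two_mul _).pow_abs x).symm
    have h5 : K * |x| ^ r ≤ |x| ^ (2 * (r + 1)) :=
      calc K * |x| ^ r ≤ |x| * |x| ^ r := by gcongr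
        _ = |x| ^ (r + 1) := by ring
        _ ≤ |x| ^ (2 * (r + 1)) := pow_le_pow_right₀ (by linarith) (by omega)
    rw [h4, div_mul_eq_mul_div, le_div_iff₀ hK0]
    nlinarith

lemma integrable_truncatedPow (μ : Measure ℝ) [IsFiniteMeasure μ] {K : ℝ} (hK : 0 ≤ K) (r : ℕ) :
    Integrable (truncatedPow K r) μ :=
  Integrable.of_bound (continuous_truncatedPow K r).aestronglyMeasurable (K ^ r)
    (ae_of_all _ fun x => by simpa using abs_truncatedPow_le hK r x)

lemma abs_integral_pow_sub_truncatedPow_le {μ : Measure ℝ} [IsFiniteMeasure μ] {K : ℝ} (hK : 1 ≤ K)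
    {r : ℕ} {C : ℝ} (hint : Integrable (fun x : ℝ => x ^ r) μ)
    (hint' : Integrable (fun x : ℝ => x ^ (2 * (r + 1))) μ)
    (hC : ∫ x, x ^ (2 * (r + 1)) ∂μ ≤ C) :
    |∫ x, x ^ r ∂μ - ∫ x, truncatedPow K r x ∂μ| ≤ 2 / K * C := by
  have hK0 : 0 ≤ K := by linarith
  rw [← integral_sub hint (integrable_truncatedPow μ hK0 r)]
  calc |∫ x, (x ^ r - truncatedPow K r x) ∂μ| ≤ ∫ x, |x ^ r - truncatedPow K r x| ∂μ :=
        abs_integral_le_integral_abs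
    _ ≤ ∫ x, 2 / K * x ^ (2 * (r + 1)) ∂μ :=
        integral_mono (hint.sub (integrable_truncatedPow μ hK0 r)).abs (hint'.const_mul _)
          fun x => abs_pow_sub_truncatedPow_le hK r x
    _ = 2 / K * ∫ x, x ^ (2 * (r + 1)) ∂μ := integral_const_mul _ _
    _ ≤ 2 / K * C := by gcongr

/-- Under weak convergence with bounded even moments all moments converge: a moment of order
`2 * (r + 1)` controls the error made by truncating the moment of order `r`, uniformly along the
sequence. -/
lemma tendsto_integral_pow_of_tendsto {μ : ℕ → ProbabilityMeasure ℝ} {ν : ProbabilityMeasure ℝ}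
    (hμ : Tendsto μ atTop (𝓝 ν))
    (hint : ∀ n r, Integrable (fun x : ℝ => x ^ r) (μ n : Measure ℝ))
    (hbdd : ∀ s, ∃ C, ∀ n, ∫ x, x ^ (2 * s) ∂(μ n : Measure ℝ) ≤ C) (r : ℕ) :
    Integrable (fun x : ℝ => x ^ r) (ν : Measure ℝ) ∧
      Tendsto (fun n => ∫ x, x ^ r ∂(μ n : Measure ℝ)) atTop (𝓝 (∫ x, x ^ r ∂(ν : Measure ℝ))) := by
  have hnn : ∀ (s : ℕ) (n : ℕ), 0 ≤ ∫ x, x ^ (2 * s) ∂(μ n : Measure ℝ) := fun s n =>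
    integral_nonneg fun x => (even_two_mul s).pow_nonneg x
  have hν : Integrable (fun x : ℝ => x ^ r) (ν : Measure ℝ) := by
    obtain ⟨C, hC⟩ := hbdd r
    exact integrable_pow_of_integrable_pow_two_mul
      (integrable_pow_and_integral_le_of_tendsto hμ ((hnn r 0).trans (hC 0))
        (fun n => hint n _) hC).1
  refine ⟨hν, ?_⟩
  obtain ⟨C, hC⟩ := hbdd (r + 1)
  have hC0 : 0 ≤ C := (hnn (r + 1) 0).trans (hC 0)
  obtain ⟨hν', hCν⟩ := integrable_pow_and_integral_le_of_tendsto hμ hC0 (fun n => hint n _) hC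
  rw [Metric.tendsto_atTop]
  intro ε hε
  -- the two truncation errors are at most `2 / K * C < ε / 3` each
  set K : ℝ := 1 + 6 * C / ε with hKdef
  have hK1 : 1 ≤ K := by
    rw [hKdef]
    have : 0 ≤ 6 * C / ε := by positivity
    linarith
  have hK0 : 0 < K := by linarith
  have hKC : 2 / K * C < ε / 3 := by
    rw [div_mul_eq_mul_div, div_lt_iff₀ hK0, hKdef]
    have : ε / 3 * (1 + 6 * C / ε) = ε / 3 + 2 * C := by
      field_simp
      ring
    rw [this]
    linarith
  let f : BoundedContinuousFunction ℝ ℝ := BoundedContinuousFunction.ofNormedAddCommGroup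
    (truncatedPow K r) (continuous_truncatedPow K r) (K ^ r)
    fun x => by simpa using abs_truncatedPow_le hK0.le r x
  have hf := (ProbabilityMeasure.tendsto_iff_forall_integral_tendsto.1 hμ) f
  obtain ⟨N, hN⟩ := Metric.tendsto_atTop.1 hf (ε / 3) (by positivity)
  refine ⟨N, fun n hn => ?_⟩
  have h1 := hN n hn
  rw [Real.dist_eq] at h1 ⊢
  change |∫ x, truncatedPow K r x ∂(μ n : Measure ℝ) - ∫ x, truncatedPow K r x ∂(ν : Measure ℝ)|
    < ε / 3 at h1
  have h2 := abs_integral_pow_sub_truncatedPow_le hK1 (hint n r) (hint n _) (hC n)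
  have h3 := abs_integral_pow_sub_truncatedPow_le hK1 hν hν' hCν
  rw [abs_lt] at h1 ⊢
  rw [abs_le] at h2 h3
  constructor <;> linarith [h1.1, h1.2, h2.1, h2.2, h3.1, h3.2]

lemma isTightMeasureSet_of_integral_sq_le {S : Set (ProbabilityMeasure ℝ)} {C : ℝ}
    (hint : ∀ μ ∈ S, Integrable (fun x : ℝ => x ^ (2 * 1)) (μ : Measure ℝ))
    (hC : ∀ μ ∈ S, ∫ x, x ^ (2 * 1) ∂(μ : Measure ℝ) ≤ C) :
    IsTightMeasureSet {((μ : ProbabilityMeasure ℝ) : Measure ℝ) | μ ∈ S} := by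
  apply isTightMeasureSet_of_tendsto_measure_norm_gt
  have hlim : Tendsto (fun r : ℝ => ENNReal.ofReal C / ENNReal.ofReal (r ^ 2)) atTop (𝓝 0) := by
    have h1 : Tendsto (fun r : ℝ => ENNReal.ofReal (r ^ 2)) atTop (𝓝 ⊤) :=
      ENNReal.tendsto_ofReal_nhds_top.2 (tendsto_pow_atTop two_ne_zero)
    simpa using ENNReal.Tendsto.const_div h1 (Or.inr ENNReal.ofReal_ne_top)
  refine tendsto_of_tendsto_of_tendsto_of_le_of_le' tendsto_const_nhds hlim
    (Eventually.of_forall fun _ => zero_le) ?_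
  filter_upwards [eventually_gt_atTop (0 : ℝ)] with r hr
  refine iSup₂_le fun μ' hμ' => ?_
  obtain ⟨μ, hμ, rfl⟩ := hμ'
  rw [ENNReal.le_div_iff_mul_le (Or.inl (by simp [hr.ne'])) (Or.inl ENNReal.ofReal_ne_top),
    mul_comm]
  calc ENNReal.ofReal (r ^ 2) * (μ : Measure ℝ) {x | r < ‖x‖}
      ≤ ENNReal.ofReal (r ^ 2) *
          (μ : Measure ℝ) {x | ENNReal.ofReal (r ^ 2) ≤ ENNReal.ofReal (x ^ (2 * 1))} := by
        gcongr with x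
        intro hx
        rw [mul_one, ← sq_abs x]
        exact ENNReal.ofReal_le_ofReal (pow_le_pow_left₀ hr.le hx.le 2)
    _ ≤ ∫⁻ x, ENNReal.ofReal (x ^ (2 * 1)) ∂(μ : Measure ℝ) :=
        mul_meas_ge_le_lintegral (by fun_prop) _
    _ ≤ ENNReal.ofReal C := lintegral_pow_two_mul_le (hint μ hμ) (hC μ hμ)

/-- **Method of moments**: if all moments of a sequence of probability measures converge and if at
most one probability measure has the limits as its moments, then such a measure exists and is the
weak limit of the sequence. -/
theorem exists_tendsto_of_tendsto_moments {μ : ℕ → ProbabilityMeasure ℝ} {m : ℕ → ℝ}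
    (hint : ∀ n r, Integrable (fun x : ℝ => x ^ r) (μ n : Measure ℝ))
    (hm : ∀ r, Tendsto (fun n => ∫ x, x ^ r ∂(μ n : Measure ℝ)) atTop (𝓝 (m r)))
    (huniq : ∀ ν ν' : ProbabilityMeasure ℝ,
      (∀ r, Integrable (fun x : ℝ => x ^ r) (ν : Measure ℝ) ∧
        ∫ x, x ^ r ∂(ν : Measure ℝ) = m r) →
      (∀ r, Integrable (fun x : ℝ => x ^ r) (ν' : Measure ℝ) ∧
        ∫ x, x ^ r ∂(ν' : Measure ℝ) = m r) → ν = ν') :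
    ∃ ν : ProbabilityMeasure ℝ, (∀ r, Integrable (fun x : ℝ => x ^ r) (ν : Measure ℝ) ∧
      ∫ x, x ^ r ∂(ν : Measure ℝ) = m r) ∧ Tendsto μ atTop (𝓝 ν) := by
  have hbdd : ∀ s, ∃ C, ∀ n, ∫ x, x ^ (2 * s) ∂(μ n : Measure ℝ) ≤ C := fun s => by
    obtain ⟨C, hC⟩ := (hm (2 * s)).bddAbove_range
    exact ⟨C, fun n => hC ⟨n, rfl⟩⟩
  have hlim : ∀ (φ : ℕ → ℕ) (ν : ProbabilityMeasure ℝ), Tendsto φ atTop atTop →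
      Tendsto (μ ∘ φ) atTop (𝓝 ν) → ∀ r, Integrable (fun x : ℝ => x ^ r) (ν : Measure ℝ) ∧
        ∫ x, x ^ r ∂(ν : Measure ℝ) = m r := by
    intro φ ν hφ hν r
    obtain ⟨h1, h2⟩ := tendsto_integral_pow_of_tendsto hν (fun n => hint _)
      (fun s => (hbdd s).imp fun C hC n => hC _) r
    exact ⟨h1, tendsto_nhds_unique h2 ((hm r).comp hφ)⟩
  have hcomp : IsCompact (closure (Set.range μ)) := by
    obtain ⟨C, hC⟩ := hbdd 1
    apply isCompact_closure_of_isTightMeasureSet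
    apply isTightMeasureSet_of_integral_sq_le (C := C)
    · rintro _ ⟨n, rfl⟩
      exact hint n _
    · rintro _ ⟨n, rfl⟩
      exact hC n
  have hsub : ∀ ns : ℕ → ℕ, ∃ ν : ProbabilityMeasure ℝ, ∃ φ : ℕ → ℕ, StrictMono φ ∧
      Tendsto (fun n => μ (ns (φ n))) atTop (𝓝 ν) := fun ns => by
    obtain ⟨ν, -, φ, hφ, h⟩ := hcomp.tendsto_subseq (x := fun n => μ (ns n))
      fun n => subset_closure ⟨_, rfl⟩
    exact ⟨ν, φ, hφ, h⟩
  obtain ⟨ν, φ, hφ, hν⟩ := hsub id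
  have hνm := hlim _ ν hφ.tendsto_atTop hν
  refine ⟨ν, hνm, tendsto_of_subseq_tendsto fun ns hns => ?_⟩
  obtain ⟨ν', ψ, hψ, hν'⟩ := hsub ns
  have := huniq ν ν' hνm (hlim (fun n => ns (ψ n)) ν' (hns.comp hψ.tendsto_atTop) hν')
  exact ⟨ψ, this ▸ hν'⟩

/-! ### Determinacy of moments -/

/-- If the even moments of a measure grow at most like factorials, then its moment generating
function is finite in a neighbourhood of `0`. -/
lemma integrable_exp_mul_of_integral_pow_le {ν : Measure ℝ} {c : ℝ}
    (hint : ∀ r : ℕ, Integrable (fun x : ℝ => x ^ (2 * r)) ν)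
    (hc : ∀ r : ℕ, ∫ x, x ^ (2 * r) ∂ν ≤ c * (2 * r).factorial) {t : ℝ} (ht : |t| < 1) :
    Integrable (fun x => Real.exp (t * x)) ν := by
  have hcosh : Integrable (fun x => Real.cosh (t * x)) ν := by
    refine ⟨by fun_prop, ?_⟩
    rw [hasFiniteIntegral_iff_ofReal (ae_of_all _ fun x => (Real.cosh_pos _).le)]
    have h1 : ∀ x : ℝ, ENNReal.ofReal (Real.cosh (t * x)) =
        ∑' r : ℕ, ENNReal.ofReal (t ^ (2 * r) / (2 * r).factorial * x ^ (2 * r)) := by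
      intro x
      have hs := Real.hasSum_cosh (t * x)
      rw [← hs.tsum_eq, ENNReal.ofReal_tsum_of_nonneg _ hs.summable]
      · congr 1
        ext1 r
        rw [mul_pow, div_mul_eq_mul_div]
      · intro r
        have := (even_two_mul r).pow_nonneg (t * x)
        positivity
    simp_rw [h1]
    rw [lintegral_tsum fun r => by fun_prop]
    have hq0 : 0 ≤ t ^ 2 := sq_nonneg t
    have hq1 : t ^ 2 < 1 := by
      rw [← sq_abs]
      exact pow_lt_one₀ (abs_nonneg t) ht two_ne_zero
    have hsum : Summable fun r : ℕ => c * (t ^ 2) ^ r :=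
      (summable_geometric_of_lt_one hq0 hq1).mul_left c
    refine lt_of_le_of_lt (ENNReal.tsum_le_tsum fun r => ?_)
      (hsum.tsum_ofReal_lt_top)
    have ht0 : 0 ≤ t ^ (2 * r) := (even_two_mul r).pow_nonneg t
    rw [← ofReal_integral_eq_lintegral_ofReal ((hint r).const_mul _)
      (ae_of_all _ fun x => mul_nonneg (by positivity) ((even_two_mul r).pow_nonneg x)),
      integral_const_mul]
    refine ENNReal.ofReal_le_ofReal ?_
    calc t ^ (2 * r) / (2 * r).factorial * ∫ x, x ^ (2 * r) ∂ν
        ≤ t ^ (2 * r) / (2 * r).factorial * (c * (2 * r).factorial) := by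
          gcongr
          exact hc r
      _ = c * (t ^ 2) ^ r := by
          rw [← pow_mul]
          field_simp
  refine (hcosh.const_mul 2).mono' (by fun_prop) (ae_of_all _ fun x => ?_)
  rw [Real.norm_eq_abs, abs_of_pos (Real.exp_pos _), Real.cosh_eq]
  have := Real.exp_pos (-(t * x))
  linarith

/-- A measure whose even moments grow at most like factorials is determined by its moments: the
complex moment generating functions of two such measures are analytic in a common strip around the
imaginary axis and have the same Taylor series at `0`. -/
theorem MeasureTheory.Measure.ext_of_integral_pow_eq {ν ν' : Measure ℝ} [IsFiniteMeasure ν] [IsFiniteMeasure ν']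
    {c : ℝ} (hint : ∀ r : ℕ, Integrable (fun x : ℝ => x ^ r) ν)
    (hint' : ∀ r : ℕ, Integrable (fun x : ℝ => x ^ r) ν')
    (heq : ∀ r : ℕ, ∫ x, x ^ r ∂ν = ∫ x, x ^ r ∂ν')
    (hc : ∀ r : ℕ, ∫ x, x ^ (2 * r) ∂ν ≤ c * (2 * r).factorial) : ν = ν' := by
  have hball : ∀ {κ : Measure ℝ}, (∀ r : ℕ, Integrable (fun x : ℝ => x ^ r) κ) →
      (∀ r : ℕ, ∫ x, x ^ (2 * r) ∂κ ≤ c * (2 * r).factorial) →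
      Set.Ioo (-1 : ℝ) 1 ⊆ interior (integrableExpSet id κ) := by
    intro κ h1 h2
    refine interior_maximal (fun t ht => ?_) isOpen_Ioo
    exact integrable_exp_mul_of_integral_pow_le (fun r => h1 _) h2 (abs_lt.2 ht)
  have hν := hball hint hc
  have hν' := hball hint' fun r => heq (2 * r) ▸ hc r
  let U : Set ℂ := {z | z.re ∈ Set.Ioo (-1 : ℝ) 1}
  have hU : Convex ℝ U := (convex_Ioo (-1 : ℝ) 1).linear_preimage Complex.reLm
  have h0 : (0 : ℂ).re ∈ Set.Ioo (-1 : ℝ) 1 := by simp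
  have hA : AnalyticOnNhd ℂ (complexMGF id ν) U := analyticOnNhd_complexMGF.mono fun z hz => hν hz
  have hA' : AnalyticOnNhd ℂ (complexMGF id ν') U :=
    analyticOnNhd_complexMGF.mono fun z hz => hν' hz
  have hderiv : ∀ n, iteratedDeriv n (complexMGF id ν) 0 = iteratedDeriv n (complexMGF id ν') 0 := by
    intro n
    rw [iteratedDeriv_complexMGF (hν h0), iteratedDeriv_complexMGF (hν' h0)]
    simp only [id, zero_mul, Complex.exp_zero, mul_one]
    have h := congrArg (fun x : ℝ => (x : ℂ)) (heq n)
    simp only [← integral_complex_ofReal, Complex.ofReal_pow] at h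
    exact h
  have hloc : complexMGF id ν =ᶠ[𝓝 0] complexMGF id ν' := by
    have h1 := (hA 0 h0).hasFPowerSeriesAt
    have h2 := (hA' 0 h0).hasFPowerSeriesAt
    simp_rw [← hderiv] at h2
    filter_upwards [(h1.eventually_hasSum_sub), h2.eventually_hasSum_sub] with z hz1 hz2
    exact hz1.unique hz2
  have hEq : Set.EqOn (complexMGF id ν) (complexMGF id ν') U :=
    hA.eqOn_of_preconnected_of_eventuallyEq hA' hU.isPreconnected h0 hloc
  refine Measure.ext_of_charFun ?_
  ext t
  rw [← complexMGF_id_mul_I, ← complexMGF_id_mul_I]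
  exact hEq (by simp [U])

/-- The moments of the Mittag-Leffler distribution grow at most like factorials because the Gamma
function is bounded away from `0` on the positive half-line. -/
lemma IsMittagLeffler.unique {α : ℝ} (hα : 0 ≤ α) {ν ν' : ProbabilityMeasure ℝ}
    (h : IsMittagLeffler α (ν : Measure ℝ)) (h' : IsMittagLeffler α (ν' : Measure ℝ)) :
    ν = ν' := by
  obtain ⟨x₀, hx₀, hmin⟩ := Real.exists_isMinOn_Gamma_Ioi
  have hpos : 0 < Real.Gamma x₀ := Real.Gamma_pos_of_pos (by linarith [hx₀.1])
  suffices (ν : Measure ℝ) = (ν' : Measure ℝ) from Subtype.ext this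
  refine Measure.ext_of_integral_pow_eq (c := 1 / Real.Gamma x₀) (fun r => (h r).1)
    (fun r => (h' r).1) (fun r => (h r).2.trans (h' r).2.symm) fun r => ?_
  rw [(h (2 * r)).2, one_div_mul_eq_div]
  have harg : (0 : ℝ) < ((2 * r : ℕ) : ℝ) * α + 1 := by positivity
  exact div_le_div_of_nonneg_left (by positivity) hpos (hmin harg)

/-! ### Moments of the growth chain -/

lemma integrable_growthLaw (a : I) (n : ℕ) (g : ℕ → ℝ) :
    Integrable g (growthLaw a n).toMeasure := by
  have hfin : (growthLaw a n).support.Finite := by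
    refine (Set.finite_Iic (n + 1)).subset fun k hk => ?_
    by_contra! hlt
    simp only [Set.mem_Iic, not_le] at hlt
    cases n with
    | zero =>
      rw [growthLaw, PMF.support_pure, Set.mem_singleton_iff] at hk
      omega
    | succ n => exact hk (growthLaw_apply_eq_zero_of_lt a n (by omega))
  rw [← PMF.restrict_toMeasure_support]
  exact IntegrableOn.of_finite hfin

lemma integral_growthLaw (a : I) (n : ℕ) (g : ℕ → ℝ) :
    ∫ k, g k ∂(growthLaw a (n + 1)).toMeasure =
      ∑ k ∈ Finset.range (n + 1), (growthLaw a (n + 1) (k + 1)).toReal * g (k + 1) := by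
  rw [PMF.integral_eq_tsum _ _ (integrable_growthLaw a (n + 1) g),
    tsum_eq_sum (s := Finset.range (n + 2)), Finset.sum_range_succ']
  · simp [growthLaw_apply_zero]
  · intro k hk
    rw [Finset.mem_range, not_lt] at hk
    rw [growthLaw_apply_eq_zero_of_lt a n (by omega)]
    simp

/-- The rising factorials are eigenfunctions of the growth chain. -/
lemma integral_ascFactorial_growthLaw_succ (a : I) (n r : ℕ) :
    ∫ k, (k.ascFactorial r : ℝ) ∂(growthLaw a (n + 2)).toMeasure =
      (1 + a * r / (n + 1 : ℕ)) * ∫ k, (k.ascFactorial r : ℝ) ∂(growthLaw a (n + 1)).toMeasure := by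
  have hn : ((n + 1 : ℕ) : ℝ) ≠ 0 := by positivity
  rw [integral_growthLaw, integral_growthLaw]
  simp_rw [toReal_growthLaw_succ, add_mul _ _ (Nat.cast (Nat.ascFactorial _ _) : ℝ)]
  rw [Finset.sum_add_distrib, Finset.sum_range_succ, growthLaw_apply_eq_zero_of_lt a n (by omega),
    Finset.sum_range_succ' _ (n + 1)]
  simp only [ENNReal.toReal_zero, mul_zero, zero_mul, add_zero, Nat.cast_zero, zero_div]
  rw [← Finset.sum_add_distrib, Finset.mul_sum]
  refine Finset.sum_congr rfl fun k _ => ?_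
  have h := congrArg (Nat.cast : ℕ → ℝ) (Nat.succ_ascFactorial (k + 1) r)
  rw [Nat.succ_eq_add_one] at h
  push_cast at h ⊢
  field_simp
  linear_combination (growthLaw a (n + 1) (k + 1)).toReal * (a : ℝ) * h

lemma integral_ascFactorial_growthLaw (a : I) (n r : ℕ) :
    ∫ k, (k.ascFactorial r : ℝ) ∂(growthLaw a (n + 1)).toMeasure =
      r.factorial * ∏ i ∈ Finset.range n, (1 + (r * a : ℝ) / (i + 1 : ℕ)) := by
  induction n with
  | zero =>
    rw [integral_growthLaw]
    simp [growthLaw, Nat.one_ascFactorial]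
  | succ n ih =>
    rw [integral_ascFactorial_growthLaw_succ, ih, Finset.prod_range_succ, mul_comm (a : ℝ)]
    ring

/-- Euler's product formula for the Gamma function. -/
lemma tendsto_prod_div_rpow {x : ℝ} (hx : 0 ≤ x) :
    Tendsto (fun n : ℕ => (∏ i ∈ Finset.range n, (1 + x / (i + 1 : ℕ))) / ((n + 1 : ℕ) : ℝ) ^ x)
      atTop (𝓝 (1 / Real.Gamma (x + 1))) := by
  have hG : Real.Gamma (x + 1) ≠ 0 := (Real.Gamma_pos_of_pos (by linarith)).ne'
  have hseq := Real.GammaSeq_tendsto_Gamma (x + 1)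
  have hprod : ∀ n : ℕ, ∏ i ∈ Finset.range n, (1 + x / (i + 1 : ℕ)) =
      (∏ i ∈ Finset.range n, (x + 1 + i)) / n.factorial := by
    intro n
    induction n with
    | zero => simp
    | succ n ih =>
      rw [Finset.prod_range_succ, Finset.prod_range_succ, ih, Nat.factorial_succ]
      push_cast
      have : (n.factorial : ℝ) ≠ 0 := by positivity
      field_simp
      ring
  have h1 : Tendsto (fun n : ℕ => (n : ℝ) / (n + (x + 1))) atTop (𝓝 1) :=
    tendsto_natCast_div_add_atTop (x + 1)
  have h2 : Tendsto (fun n : ℕ => ((n : ℝ) / (n + 1)) ^ x) atTop (𝓝 1) := by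
    have := (tendsto_natCast_div_add_atTop (1 : ℝ)).rpow_const (p := x) (Or.inl one_ne_zero)
    simpa using this
  -- `GammaSeq (x + 1) n = n ^ (x + 1) / (P n * (n + (x + 1)))`, where `P n` is the product
  have h3 := (h1.div hseq hG).mul h2
  rw [mul_one] at h3
  refine h3.congr' ?_
  filter_upwards [eventually_gt_atTop 0] with n hn
  have hn' : (0 : ℝ) < n := by exact_mod_cast hn
  have hP : ∏ i ∈ Finset.range n, (x + 1 + i) ≠ 0 :=
    Finset.prod_ne_zero_iff.2 fun i _ => by positivity
  rw [hprod, Pi.div_apply, Real.GammaSeq, Finset.prod_range_succ,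
    Real.div_rpow hn'.le (by positivity), Real.rpow_add hn', Real.rpow_one]
  have e1 : (0 : ℝ) < (n : ℝ) ^ x := Real.rpow_pos_of_pos hn' x
  have e2 : (0 : ℝ) < ((n : ℝ) + 1) ^ x := Real.rpow_pos_of_pos (by positivity) x
  have e3 : (n.factorial : ℝ) ≠ 0 := by positivity
  have e4 : (n : ℝ) + (x + 1) ≠ 0 := by positivity
  have e5 : x + 1 + (n : ℝ) ≠ 0 := by positivity
  push_cast
  field_simp
  ring

lemma tendsto_integral_ascFactorial (a : I) (r : ℕ) :
    Tendsto (fun n : ℕ => (∫ k, (k.ascFactorial r : ℝ) ∂(growthLaw a (n + 1)).toMeasure) /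
      ((n + 1 : ℕ) : ℝ) ^ (r * a : ℝ)) atTop
      (𝓝 (r.factorial / Real.Gamma (r * a + 1))) := by
  have h := (tendsto_prod_div_rpow (x := r * a) (mul_nonneg (by positivity) a.2.1)).const_mul
    (r.factorial : ℝ)
  rw [mul_one_div] at h
  refine h.congr fun n => ?_
  rw [integral_ascFactorial_growthLaw, mul_div_assoc]

lemma pow_le_ascFactorial (k r : ℕ) : k ^ r ≤ k.ascFactorial r := by
  induction r with
  | zero => simp
  | succ r ih =>
    rw [pow_succ', Nat.ascFactorial_succ]
    exact Nat.mul_le_mul (Nat.le_add_right _ _) ih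

lemma ascFactorial_succ_le (k r : ℕ) :
    k.ascFactorial (r + 1) ≤ k ^ (r + 1) + (r + 1) ^ 2 * k.ascFactorial r := by
  induction r with
  | zero => simp [Nat.ascFactorial_succ]
  | succ r ih =>
    have h1 : k * k.ascFactorial r ≤ k.ascFactorial (r + 1) := by
      rw [Nat.ascFactorial_succ]
      exact Nat.mul_le_mul_right _ (Nat.le_add_right _ _)
    calc k.ascFactorial (r + 1 + 1)
        = k * k.ascFactorial (r + 1) + (r + 1) * k.ascFactorial (r + 1) := by
          rw [Nat.ascFactorial_succ, add_mul]
      _ ≤ k * (k ^ (r + 1) + (r + 1) ^ 2 * k.ascFactorial r) +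
            (r + 1) * k.ascFactorial (r + 1) := by gcongr
      _ = k ^ (r + 1 + 1) + (r + 1) ^ 2 * (k * k.ascFactorial r) +
            (r + 1) * k.ascFactorial (r + 1) := by ring
      _ ≤ k ^ (r + 1 + 1) + (r + 1) ^ 2 * k.ascFactorial (r + 1) +
            (r + 1) * k.ascFactorial (r + 1) := by gcongr
      _ ≤ k ^ (r + 1 + 1) + (r + 1 + 1) ^ 2 * k.ascFactorial (r + 1) := by nlinarith

/-- The powers have the same asymptotic expectations as the rising factorials because the two differ
by at most a multiple of the rising factorial of the next lower order. -/
lemma tendsto_integral_pow_growthLaw {a : I} (ha : 0 < (a : ℝ)) (r : ℕ) :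
    Tendsto (fun n : ℕ => (∫ k, (k : ℝ) ^ r ∂(growthLaw a (n + 1)).toMeasure) /
      ((n + 1 : ℕ) : ℝ) ^ (r * a : ℝ)) atTop
      (𝓝 (r.factorial / Real.Gamma (r * a + 1))) := by
  cases r with
  | zero =>
    have h := tendsto_integral_ascFactorial a 0
    simp only [Nat.ascFactorial_zero, Nat.cast_one] at h
    simpa only [pow_zero] using h
  | succ r =>
    have hup := tendsto_integral_ascFactorial a (r + 1)
    have hdecay : Tendsto (fun n : ℕ => (((n + 1 : ℕ) : ℝ) ^ (a : ℝ))⁻¹) atTop (𝓝 0) :=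
      ((tendsto_rpow_atTop ha).comp
        (tendsto_natCast_atTop_atTop.comp (tendsto_add_atTop_nat 1))).inv_tendsto_atTop
    have hlow := hup.sub (((tendsto_integral_ascFactorial a r).mul hdecay).const_mul
      (((r + 1) ^ 2 : ℕ) : ℝ))
    simp only [mul_zero, sub_zero] at hlow
    refine tendsto_of_tendsto_of_tendsto_of_le_of_le hlow hup (fun n => ?_) fun n => ?_
    · have hn : (0 : ℝ) < ((n + 1 : ℕ) : ℝ) := by positivity
      have hexp : ((n + 1 : ℕ) : ℝ) ^ (((r + 1 : ℕ) : ℝ) * a) =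
          ((n + 1 : ℕ) : ℝ) ^ ((r : ℝ) * a) * ((n + 1 : ℕ) : ℝ) ^ (a : ℝ) := by
        rw [← Real.rpow_add hn]
        push_cast
        ring_nf
      have hle : ∫ k, (k.ascFactorial (r + 1) : ℝ) ∂(growthLaw a (n + 1)).toMeasure ≤
          ∫ k, (k : ℝ) ^ (r + 1) ∂(growthLaw a (n + 1)).toMeasure +
            (((r + 1) ^ 2 : ℕ) : ℝ) *
              ∫ k, (k.ascFactorial r : ℝ) ∂(growthLaw a (n + 1)).toMeasure := by
        rw [← integral_const_mul, ← integral_add (integrable_growthLaw _ _ _)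
          (integrable_growthLaw _ _ _)]
        refine integral_mono (integrable_growthLaw _ _ _) (integrable_growthLaw _ _ _) fun k => ?_
        have h := ascFactorial_succ_le k r
        beta_reduce
        exact_mod_cast h
      beta_reduce
      rw [← div_eq_mul_inv, div_div, ← hexp, ← mul_div_assoc, ← sub_div]
      gcongr
      linarith
    · refine div_le_div_of_nonneg_right ?_ (by positivity)
      refine integral_mono (integrable_growthLaw _ _ _) (integrable_growthLaw _ _ _) fun k => ?_
      exact_mod_cast pow_le_ascFactorial k (r + 1)

/-- The law of the growth chain at time `n`, scaled by `n ^ a`. -/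
noncomputable def scaledGrowthLaw (a : I) (n : ℕ) : ProbabilityMeasure ℝ :=
  ⟨(growthLaw a n).toMeasure.map fun k : ℕ => (k : ℝ) / (n : ℝ) ^ (a : ℝ),
    Measure.isProbabilityMeasure_map measurable_from_top.aemeasurable⟩

lemma integrable_pow_scaledGrowthLaw (a : I) (n r : ℕ) :
    Integrable (fun x : ℝ => x ^ r) (scaledGrowthLaw a n : Measure ℝ) := by
  refine (integrable_map_measure (by fun_prop) measurable_from_top.aemeasurable).2 ?_
  exact integrable_growthLaw _ _ _

lemma integral_pow_scaledGrowthLaw (a : I) (n r : ℕ) :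
    ∫ x, x ^ r ∂(scaledGrowthLaw a n : Measure ℝ) =
      (∫ k, (k : ℝ) ^ r ∂(growthLaw a n).toMeasure) / (n : ℝ) ^ (r * a : ℝ) := by
  change ∫ x, x ^ r ∂((growthLaw a n).toMeasure.map _) = _
  rw [integral_map measurable_from_top.aemeasurable (by fun_prop), ← integral_div]
  congr 1
  ext1 k
  rw [div_pow, ← Real.rpow_mul_natCast (by positivity), mul_comm (r : ℝ)]

theorem exists_isMittagLeffler_tendsto_scaledGrowthLaw {a : I} (ha : 0 < (a : ℝ)) :
    ∃ ν : ProbabilityMeasure ℝ, IsMittagLeffler a (ν : Measure ℝ) ∧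
      Tendsto (scaledGrowthLaw a) atTop (𝓝 ν) := by
  refine exists_tendsto_of_tendsto_moments (integrable_pow_scaledGrowthLaw a) (fun r => ?_)
    fun ν ν' h h' => IsMittagLeffler.unique ha.le h h'
  rw [← tendsto_add_atTop_iff_nat 1]
  simp_rw [integral_pow_scaledGrowthLaw]
  exact tendsto_integral_pow_growthLaw ha r

/-! ### The length of the leftmost path -/

theorem mainTheorem2 (p : I) (hp0 : 0 < (p : ℝ)) (hp1 : (p : ℝ) < 1) :
    (∀ n m : ℕ, 1 ≤ m → m ≤ n →
      (bernoulliNetwork p n).toMeasure.real {G : SPNetwork | G.leftmostLength = m} =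
        ∑ j ∈ Finset.range m, ((m - 1).choose j : ℝ) * (-1) ^ (n + j - 1) *
          Ring.choose ((j : ℝ) - (p : ℝ) * ((j : ℝ) + 1)) (n - 1)) ∧
    (∀ n : ℕ, 1 ≤ n →
      IdentDistrib SPNetwork.leftmostLength SPNetwork.sourceDegree
        (bernoulliNetwork p n).toMeasure (bernoulliNetwork (σ p) n).toMeasure) ∧
    ∃ ν : ProbabilityMeasure ℝ,
      IsMittagLeffler (1 - (p : ℝ)) (ν : Measure ℝ) ∧
      (∀ ν' : ProbabilityMeasure ℝ,
        IsMittagLeffler (1 - (p : ℝ)) (ν' : Measure ℝ) → ν' = ν) ∧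
      TendstoInDistribution
        (fun (n : ℕ) (G : SPNetwork) => (G.leftmostLength : ℝ) / (n : ℝ) ^ (1 - (p : ℝ)))
        atTop (id : ℝ → ℝ) (fun n : ℕ => (bernoulliNetwork p n).toMeasure)
        (ν : Measure ℝ) := by
  refine ⟨fun n m hm hmn => ?_, fun n _ => ?_, ?_⟩
  · obtain ⟨m, rfl⟩ := Nat.exists_eq_add_of_le' hm
    obtain ⟨n, rfl⟩ := Nat.exists_eq_add_of_le' (hm.trans hmn)
    have h1 : (bernoulliNetwork p (n + 1)).toMeasure.real
        {G : SPNetwork | G.leftmostLength = m + 1} =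
        (growthLaw (σ p) (n + 1) (m + 1)).toReal := by
      rw [← PMF.toMeasure_apply_singleton _ _ (measurableSet_singleton _),
        ← map_toMeasure_leftmostLength, Measure.map_apply measurable_from_top
          (measurableSet_singleton _)]
      rfl
    rw [h1, toReal_growthLaw_apply]
    refine Finset.sum_congr rfl fun j _ => ?_
    have e1 : ((σ p : I) : ℝ) * (j + 1) - 1 = (j : ℝ) - p * (j + 1) := by
      rw [unitInterval.coe_symm_eq]
      ring
    rw [e1, show n + 1 + j - 1 = n + j by omega]
    rfl
  · refine ⟨measurable_from_top.aemeasurable, measurable_from_top.aemeasurable, ?_⟩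
    rw [map_toMeasure_leftmostLength, map_toMeasure_sourceDegree]
  · have ha : 0 < ((σ p : I) : ℝ) := by
      rw [unitInterval.coe_symm_eq]
      linarith
    obtain ⟨ν, hν, hlim⟩ := exists_isMittagLeffler_tendsto_scaledGrowthLaw ha
    rw [unitInterval.coe_symm_eq] at hν
    refine ⟨ν, hν, fun ν' hν' => IsMittagLeffler.unique (by linarith) hν' hν,
      ⟨fun n => measurable_from_top.aemeasurable, aemeasurable_id, ?_⟩⟩
    have hid : (⟨(ν : Measure ℝ).map id, Measure.isProbabilityMeasure_map aemeasurable_id⟩ :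
        ProbabilityMeasure ℝ) = ν := Subtype.ext Measure.map_id
    rw [hid]
    refine hlim.congr fun n => Subtype.ext ?_
    change (growthLaw (σ p) n).toMeasure.map _ = (bernoulliNetwork p n).toMeasure.map _
    rw [← map_toMeasure_leftmostLength, Measure.map_map measurable_from_top measurable_from_top,
      unitInterval.coe_symm_eq]
    rfl
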